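/- Let $N\ge 0$ and let $S(z)=\sum_{n=0}^{2N}C_nz^n$ be an $m\times m$ matrix polynomial, $C_n\in\mathbb C^{m\times m}$, such that $S(x)$ is (Hermitian) positive definite for almost every $x\in\mathbb R$. Then there are $A_0,\dots,A_N\in\mathbb C^{m\times m}$ such that the matrix polynomial $S^+(z)=\sum_{n=0}^{N}A_nz^n$ (of degree at most $N$, with $A_N\neq 0$ if $C_{2N}\neq 0$) and its adjoint $S^-(z):=\big(S^+(\bar z)\big)^*=\sum_{n=0}^{N}A_n^*z^n$ (where $^*$ is the conjugate transpose of a matrix) satisfy $$S(z)=S^+(z)\,S^-(z)\quad\text{for all } z\in\mathbb C,$$ $$\det S^+(z)\neq 0\ \text{ whenever } \operatorname{Im} z>0,\qquad \det S^-(z)\neq 0\ \text{ whenever } \operatorname{Im} z<0.$$ Moreover, $S^+$ is unique up to a constant unitary factor on the right: a matrix polynomial $T(z)=\sum_{n=0}^{N}B_nz^n$ satisfies $S(z)=T(z)\,T(\bar z)^*$ for all $z\in\mathbb C$ and $\det T(z)\ne0$ whenever $\operatorname{Im} z>0$ if and only if $T(z)=S^+(z)U$ for all $z\in\mathbb C$,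 for some constant unitary matrix $U\in\mathbb C^{m\times m}$. -/

import Mathlib

open scoped ComplexOrder Matrix

/-- The matrix polynomial function `z ↦ ∑_{n=0}^{d} C_n z^n` (only `C 0, …, C d` matter). -/
def matrixPoly {m : ℕ} (d : ℕ) (C : ℕ → Matrix (Fin m) (Fin m) ℂ) (z : ℂ) :
    Matrix (Fin m) (Fin m) ℂ :=
  ∑ n ∈ Finset.range (d + 1), z ^ n • C n

/-- The adjoint matrix function with respect to the real line, `z ↦ F(z̄)*`. -/
def adjointFun {m : ℕ} (F : ℂ → Matrix (Fin m) (Fin m) ℂ) (z : ℂ) :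
    Matrix (Fin m) (Fin m) ℂ :=
  (F (starRingEnd ℂ z))ᴴ

/-- `F` is a spectral factor of `S`: `S = F F~` on the whole complex plane, with `F~` the adjoint
of `F`, and `F` is nonsingular in the open upper half-plane. -/
structure IsSpectralFactor {m : ℕ} (S F : ℂ → Matrix (Fin m) (Fin m) ℂ) : Prop where
  factorization : ∀ z : ℂ, S z = F z * adjointFun F z
  nonsingular : ∀ z : ℂ, 0 < z.im → (F z).det ≠ 0

/-! Existence is a descent on weights `d` with `deg S j k ≤ d j + d k`. While `∑ d > 0`, `S` is a
congruence `E * S' * Eᴴ` with smaller total weight. If `det S` is nonconstant, it has a zero `a` in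
the closed upper half-plane; a kernel vector of `S(a)` replaces a basis vector, its column is
divisible by `X - a` and its diagonal entry by `(X - a)(X - ā)`. Dividing these out moves the zero
`ā` into `det E`, away from the open upper half-plane (`isReducible_of_root`). If `det S` is
constant, the matrix of top coefficients is singular, and cancelling top terms lowers the degrees
(`isReducible_of_singular_top`). At weight zero a constant positive definite matrix `Q * Qᴴ`
remains.

For uniqueness, `F⁻¹ T = F~ (T~)⁻¹` is unitary at almost every real point. The left side has no
poles above the line, the right side none below, and boundedness excludes real ones, so the entries
are bounded polynomials, hence constants. -/

open Polynomial MeasureTheory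

/-! ### Adjoint and evaluation of polynomial matrices -/

/-- Coefficientwise complex conjugation makes `ℂ[X]` a star ring. -/
noncomputable instance complexPolynomialStarRing : StarRing ℂ[X] where
  star p := p.map (starRingEnd ℂ)
  star_involutive p := by
    ext n
    simp
  star_mul p q := by
    rw [mul_comm]
    exact Polynomial.map_mul _
  star_add p q := Polynomial.map_add _

lemma star_poly_def (p : ℂ[X]) : star p = p.map (starRingEnd ℂ) := rfl

@[simp] lemma coeff_star_poly (p : ℂ[X]) (n : ℕ) : (star p).coeff n = star (p.coeff n) := by
  simp [star_poly_def]

@[simp] lemma natDegree_star_poly (p : ℂ[X]) : (star p).natDegree = p.natDegree := by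
  rw [star_poly_def, natDegree_map]

@[simp] lemma star_poly_C (a : ℂ) : star (C a) = C (star a) := by
  simp [star_poly_def]

@[simp] lemma star_poly_X : star (X : ℂ[X]) = X := by
  simp [star_poly_def]

lemma eval_star_poly (p : ℂ[X]) (z : ℂ) :
    (star p).eval z = star (p.eval (starRingEnd ℂ z)) := by
  have h : eval z (p.map (starRingEnd ℂ)) = starRingEnd ℂ (p.eval (starRingEnd ℂ z)) := by
    rw [← Polynomial.eval₂_at_apply, Polynomial.eval_map]
    simp
  exact h

/-- Evaluation of a matrix of polynomials at a point. -/
noncomputable abbrev evalMatrix {m : ℕ} (z : ℂ) :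
    Matrix (Fin m) (Fin m) ℂ[X] →+* Matrix (Fin m) (Fin m) ℂ :=
  (evalRingHom z).mapMatrix

lemma evalMatrix_conjTranspose {m : ℕ} (z : ℂ) (M : Matrix (Fin m) (Fin m) ℂ[X]) :
    evalMatrix z Mᴴ = (evalMatrix (starRingEnd ℂ z) M)ᴴ := by
  ext i j
  simp [Matrix.conjTranspose_apply, eval_star_poly]

lemma det_evalMatrix {m : ℕ} (z : ℂ) (M : Matrix (Fin m) (Fin m) ℂ[X]) :
    (evalMatrix z M).det = M.det.eval z :=
  (RingHom.map_det (evalRingHom z) M).symm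

/-! ### Polynomials on the real line -/

lemma forall_real_of_ae {P : ℂ → Prop} (hP : IsClosed {x : ℝ | P x})
    (h : ∀ᵐ x : ℝ, P x) (x : ℝ) : P x := by
  have hd : Dense {x : ℝ | P x} := Measure.dense_of_ae h
  have hx := hd x
  rwa [hP.closure_eq] at hx

lemma continuous_eval_ofReal (p : ℂ[X]) : Continuous fun x : ℝ => p.eval (x : ℂ) :=
  p.continuous.comp Complex.continuous_ofReal

lemma poly_eq_of_forall_real {p q : ℂ[X]} (h : ∀ x : ℝ, p.eval (x : ℂ) = q.eval (x : ℂ)) :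
    p = q := by
  apply Polynomial.eq_of_infinite_eval_eq
  refine (Set.infinite_range_of_injective Complex.ofReal_injective).mono ?_
  rintro _ ⟨x, rfl⟩
  exact h x

lemma poly_eq_of_ae {p q : ℂ[X]} (h : ∀ᵐ x : ℝ, p.eval (x : ℂ) = q.eval (x : ℂ)) : p = q :=
  poly_eq_of_forall_real <| forall_real_of_ae (P := fun z => p.eval z = q.eval z)
    (isClosed_eq (continuous_eval_ofReal p) (continuous_eval_ofReal q)) h

lemma eval_nonneg_of_ae {p : ℂ[X]} (h : ∀ᵐ x : ℝ, 0 ≤ p.eval (x : ℂ)) (x : ℝ) :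
    0 ≤ p.eval (x : ℂ) :=
  forall_real_of_ae (P := fun z => 0 ≤ p.eval z)
    (isClosed_le continuous_const (continuous_eval_ofReal p)) h x

lemma nonneg_of_ofReal_mul_nonneg {r : ℝ} (hr : 0 < r) {w : ℂ} (h : 0 ≤ (r : ℂ) * w) : 0 ≤ w := by
  have h1 : (0 : ℂ) ≤ ((r⁻¹ : ℝ) : ℂ) := Complex.zero_le_real.2 (inv_nonneg.2 hr.le)
  have h2 := mul_nonneg h1 h
  rwa [← mul_assoc, ← Complex.ofReal_mul, inv_mul_cancel₀ hr.ne', Complex.ofReal_one, one_mul] at h2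

/-- A real zero of a polynomial that is nonnegative on the real line is not simple. -/
lemma eval_eq_zero_of_nonneg {q : ℂ[X]} {a : ℝ}
    (h : ∀ x : ℝ, 0 ≤ ((X - C (a : ℂ)) * q).eval (x : ℂ)) : q.eval (a : ℂ) = 0 := by
  have hmul : ∀ x : ℝ, ((X - C (a : ℂ)) * q).eval (x : ℂ) = ((x - a : ℝ) : ℂ) * q.eval (x : ℂ) := by
    intro x
    simp
  -- Division by `x - a` gives opposite signs on the two sides of `a`; continuity leaves only 0.
  have hright : ∀ x ∈ Set.Ioi a, 0 ≤ q.eval (x : ℂ) := by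
    intro x hx
    have := h x
    rw [hmul] at this
    exact nonneg_of_ofReal_mul_nonneg (sub_pos.2 hx) this
  have hleft : ∀ x ∈ Set.Iio a, q.eval (x : ℂ) ≤ 0 := by
    intro x hx
    have := h x
    rw [hmul] at this
    have h2 : 0 ≤ ((a - x : ℝ) : ℂ) * (-q.eval (x : ℂ)) := by
      convert this using 1
      push_cast
      ring
    exact neg_nonneg.1 (nonneg_of_ofReal_mul_nonneg (sub_pos.2 hx) h2)
  have hc := (continuous_eval_ofReal q).tendsto a
  refine le_antisymm ?_ ?_
  · exact le_of_tendsto (hc.mono_left nhdsWithin_le_nhds)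
      (Filter.eventually_of_mem self_mem_nhdsWithin hleft)
  · exact ge_of_tendsto (hc.mono_left nhdsWithin_le_nhds)
      (Filter.eventually_of_mem self_mem_nhdsWithin hright)

/-- A polynomial that is nonnegative on the real line has even degree. -/
lemma natDegree_le_of_nonneg {p : ℂ[X]} {d : ℕ} (h : ∀ x : ℝ, 0 ≤ p.eval (x : ℂ))
    (hd : p.natDegree ≤ 2 * d + 1) : p.natDegree ≤ 2 * d := by
  -- Since `x * q(x) = x^(2d+2) * p(1/x) ≥ 0` for real `x ≠ 0`, the zero at 0 is not simple, so
  -- `q(0)`, the coefficient of `p` at `2d+1`, vanishes.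
  set q := p.reflect (2 * d + 1)
  have hq : q.eval ((0 : ℝ) : ℂ) = 0 := by
    apply eval_eq_zero_of_nonneg
    intro x
    by_cases hx : x = 0
    · simp [hx]
    have hxc : (x : ℂ) ≠ 0 := by exact_mod_cast hx
    let _ := invertibleOfNonzero (inv_ne_zero hxc)
    have h1 := eval₂_reflect_mul_pow (RingHom.id ℂ) ((x : ℂ)⁻¹) (2 * d + 1) p hd
    simp only [invOf_eq_inv, inv_inv] at h1
    have h2 : q.eval (x : ℂ) = (x : ℂ) ^ (2 * d + 1) * p.eval (x : ℂ)⁻¹ := by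
      rw [eval, eval, ← h1, mul_left_comm, ← mul_pow, mul_inv_cancel₀ hxc, one_pow, mul_one]
    have h3 : ((X - C ((0 : ℝ) : ℂ)) * q).eval (x : ℂ)
        = (((x ^ (d + 1)) ^ 2 : ℝ) : ℂ) * p.eval ((x⁻¹ : ℝ) : ℂ) := by
      rw [eval_mul, h2]
      simp
      ring
    rw [h3]
    exact mul_nonneg (Complex.zero_le_real.2 (sq_nonneg _)) (h _)
  rw [Complex.ofReal_zero, ← coeff_zero_eq_eval_zero, coeff_reflect] at hq
  simp at hq
  rw [natDegree_le_iff_coeff_eq_zero] at hd ⊢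
  intro n hn
  rcases Nat.lt_or_ge (2 * d + 1) n with h' | h'
  · exact hd n h'
  · rwa [show n = 2 * d + 1 by omega]

/-! ### Top coefficient of a determinant with weighted degrees -/

lemma coeff_prod_sum_of_natDegree_le {ι : Type*} (s : Finset ι) (f : ι → ℂ[X]) (d : ι → ℕ)
    (h : ∀ i ∈ s, (f i).natDegree ≤ d i) :
    (∏ i ∈ s, f i).coeff (∑ i ∈ s, d i) = ∏ i ∈ s, (f i).coeff (d i) := by
  classical
  induction s using Finset.induction_on with
  | empty => simp
  | insert a s ha ih =>
    rw [Finset.prod_insert ha, Finset.sum_insert ha, Finset.prod_insert ha,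
      coeff_mul_add_eq_of_natDegree_le (h a (Finset.mem_insert_self _ _)), ih]
    · exact fun i hi => h i (Finset.mem_insert_of_mem hi)
    · exact (natDegree_prod_le _ _).trans
        (Finset.sum_le_sum fun i hi => h i (Finset.mem_insert_of_mem hi))

/-- Every Leibniz term has the same degree bound `∑ (d (σ i) + d i) = 2 ∑ d`, so top coefficients
can be taken factor by factor. -/
lemma coeff_det_of_natDegree_le {m : ℕ} (S : Matrix (Fin m) (Fin m) ℂ[X]) (d : Fin m → ℕ)
    (h : ∀ i j, (S i j).natDegree ≤ d i + d j) :
    S.det.coeff (2 * ∑ i, d i) = (Matrix.of fun i j => (S i j).coeff (d i + d j)).det := by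
  rw [Matrix.det_apply, Matrix.det_apply, finsetSum_coeff]
  refine Finset.sum_congr rfl fun σ _ => ?_
  have hs : 2 * ∑ i, d i = ∑ i, (d (σ i) + d i) := by
    rw [Finset.sum_add_distrib, Equiv.sum_comp, two_mul]
  have := coeff_prod_sum_of_natDegree_le Finset.univ (fun i => S (σ i) i) (fun i => d (σ i) + d i)
    fun i _ => h _ _
  rw [Units.smul_def, Units.smul_def, coeff_smul, hs, this]
  rfl

/-! ### Positivity almost everywhere on the line -/

/-- A polynomial matrix that is positive definite almost everywhere on the real line. -/
def IsPosOnReal {m : ℕ} (S : Matrix (Fin m) (Fin m) ℂ[X]) : Prop :=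
  ∀ᵐ x : ℝ, (evalMatrix (x : ℂ) S).PosDef

namespace IsPosOnReal

variable {m : ℕ} {S : Matrix (Fin m) (Fin m) ℂ[X]}

lemma conjTranspose_eq (hS : IsPosOnReal S) : Sᴴ = S := by
  ext1 i j
  apply poly_eq_of_ae
  filter_upwards [hS] with x hx
  have h1 := congrFun (congrFun hx.isHermitian.eq i) j
  have h2 := congrFun (congrFun (evalMatrix_conjTranspose (x : ℂ) S) i) j
  rw [Complex.conj_ofReal, h1] at h2
  exact h2

lemma star_apply (hS : IsPosOnReal S) (i j : Fin m) : star (S i j) = S j i :=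
  congrFun (congrFun hS.conjTranspose_eq j) i

lemma det_ne_zero (hS : IsPosOnReal S) : S.det ≠ 0 := by
  intro h
  obtain ⟨x, hx⟩ := hS.exists
  have := hx.det_pos.ne'
  rw [det_evalMatrix, h, eval_zero] at this
  exact this rfl

lemma eval_quadratic (S : Matrix (Fin m) (Fin m) ℂ[X]) (w : Fin m → ℂ[X]) (x : ℝ) :
    (star w ⬝ᵥ (S *ᵥ w)).eval (x : ℂ) =
      star (fun j => (w j).eval (x : ℂ)) ⬝ᵥ
        (evalMatrix (x : ℂ) S *ᵥ fun j => (w j).eval (x : ℂ)) := by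
  simp [dotProduct, Matrix.mulVec, eval_finsetSum, eval_star_poly]

lemma quadratic_nonneg (hS : IsPosOnReal S) (w : Fin m → ℂ[X]) (x : ℝ) :
    0 ≤ (star w ⬝ᵥ (S *ᵥ w)).eval (x : ℂ) := by
  apply eval_nonneg_of_ae
  filter_upwards [hS] with x hx
  rw [eval_quadratic]
  exact hx.posSemidef.dotProduct_mulVec_nonneg _

/-- The nonzero constant entry keeps `w(x)` from vanishing at a point where `S` is positive
definite. -/
lemma quadratic_ne_zero (hS : IsPosOnReal S) (w : Fin m → ℂ[X]) {i : Fin m} {c : ℂ} (hc : c ≠ 0)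
    (hi : w i = C c) : star w ⬝ᵥ (S *ᵥ w) ≠ 0 := by
  intro h
  obtain ⟨x, hx⟩ := hS.exists
  have hne : (fun j => (w j).eval (x : ℂ)) ≠ 0 := by
    intro h0
    have := congrFun h0 i
    simp [hi, hc] at this
  have := hx.dotProduct_mulVec_pos hne
  rw [← eval_quadratic, h, eval_zero] at this
  exact lt_irrefl _ this

/-- `det D` has finitely many real zeros; elsewhere congruence by `D(x)` is invertible. -/
lemma conj_iff {D : Matrix (Fin m) (Fin m) ℂ[X]} (hD : D.det ≠ 0) :
    IsPosOnReal (Dᴴ * S * D) ↔ IsPosOnReal S := by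
  have hfin : {x : ℝ | D.det.eval (x : ℂ) = 0}.Finite := by
    have := (D.det.rootSet_finite ℂ).preimage (f := ((↑) : ℝ → ℂ))
      Complex.ofReal_injective.injOn
    refine this.subset fun x hx => ?_
    simp only [Set.mem_preimage, mem_rootSet]
    exact ⟨hD, by simpa using hx⟩
  have hae : ∀ᵐ x : ℝ, D.det.eval (x : ℂ) ≠ 0 := by
    have := hfin.countable.ae_notMem volume
    exact this
  refine Filter.eventually_congr ?_
  filter_upwards [hae] with x hx
  rw [map_mul, map_mul, evalMatrix_conjTranspose, Complex.conj_ofReal]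
  apply Matrix.IsUnit.posDef_star_left_conjugate_iff
  rw [Matrix.isUnit_iff_isUnit_det, det_evalMatrix]
  exact hx.isUnit

end IsPosOnReal

/-! ### One step of the descent -/

/-- Replacing the basis vector `i` by a vector polynomial `w` and then dividing the `i`-th column by
`g`, and the `i`-th row by the adjoint of `g`. -/
lemma exists_conj_reduction {m : ℕ} {S : Matrix (Fin m) (Fin m) ℂ[X]} (hS : IsPosOnReal S)
    (i : Fin m) (w u : Fin m → ℂ[X]) (c : ℂ) (hc : c ≠ 0) (hwi : w i = C c) (g p : ℂ[X])
    (hg : g ≠ 0) (hu : ∀ j, (S *ᵥ w) j = g * u j)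
    (hp : star w ⬝ᵥ (S *ᵥ w) = star g * g * p) :
    ∃ S' E : Matrix (Fin m) (Fin m) ℂ[X], S = E * S' * Eᴴ ∧ IsPosOnReal S' ∧
      (∀ z, g.eval (starRingEnd ℂ z) ≠ 0 → E.det.eval z ≠ 0) ∧
      S' i i = p ∧ (∀ j, j ≠ i → S' j i = u j ∧ S' i j = star (u j)) ∧
      ∀ j k, j ≠ i → k ≠ i → S' j k = S j k := by
  classical
  -- This is `D⁻ᴴ Wᴴ S W D⁻¹` with the quotients already carried out, so that it is visibly
  -- polynomial.
  set S' : Matrix (Fin m) (Fin m) ℂ[X] := Matrix.of fun j k =>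
    if j = i then (if k = i then p else star (u k)) else if k = i then u j else S j k with hS'
  set W : Matrix (Fin m) (Fin m) ℂ[X] := Matrix.updateCol 1 i w with hW
  set D : Matrix (Fin m) (Fin m) ℂ[X] := Matrix.diagonal (Function.update 1 i g) with hD
  have hWdet : W.det = C c := by
    rw [hW, ← Matrix.cramer_apply, Matrix.cramer_one]
    exact hwi
  have hDdet : D.det = g := by
    rw [hD, Matrix.det_diagonal, Finset.prod_update_of_mem (Finset.mem_univ i)]
    simp
  have hSW : S * W = S.updateCol i (S *ᵥ w) := by
    ext1 j k
    by_cases hk : k = i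
    · subst hk
      simp [hW, Matrix.mul_apply, Matrix.mulVec, dotProduct]
    · simp [hW, Matrix.mul_apply, Matrix.updateCol_ne hk, Matrix.one_apply]
  have hWS : ∀ M : Matrix (Fin m) (Fin m) ℂ[X], Wᴴ * M = M.updateRow i (star w ᵥ* M) := by
    intro M
    ext1 j k
    by_cases hj : j = i
    · subst hj
      simp [hW, Matrix.mul_apply, Matrix.vecMul, dotProduct]
    · simp [hW, Matrix.mul_apply, Matrix.updateRow_ne hj, Matrix.updateCol_ne hj,
        Matrix.one_apply, apply_ite]
  have hrow : ∀ k, (star w ᵥ* S) k = star ((S *ᵥ w) k) := by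
    intro k
    simp only [Matrix.vecMul, Matrix.mulVec, dotProduct, star_sum, star_mul', hS.star_apply,
      Pi.star_apply]
    exact Finset.sum_congr rfl fun _ _ => mul_comm _ _
  have hkey : Wᴴ * (S * W) = Dᴴ * S' * D := by
    rw [hWS, hSW, hD, Matrix.diagonal_conjTranspose]
    ext1 j k
    rw [Matrix.mul_diagonal, Matrix.diagonal_mul]
    by_cases hj : j = i
    · subst hj
      rw [Matrix.updateRow_self]
      by_cases hk : k = j
      · subst hk
        rw [Matrix.vecMul_updateCol, Function.update_self, hp]
        simp [hS']
        ring
      · rw [Matrix.vecMul_updateCol, Function.update_of_ne hk, hrow, hu]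
        simp [hS', hk]
    · rw [Matrix.updateRow_ne hj]
      by_cases hk : k = i
      · subst hk
        simp [hS', hj, hu, mul_comm]
      · simp [hS', hj, hk]
  have hWu : IsUnit W.det := by
    rw [hWdet]
    exact (Polynomial.isUnit_C.2 hc.isUnit)
  refine ⟨S', (W⁻¹)ᴴ * Dᴴ, ?_, ?_, ?_, ?_, ?_, ?_⟩
  · have h1 : W⁻¹ᴴ * Wᴴ = 1 := by
      rw [← Matrix.conjTranspose_mul, Matrix.mul_nonsing_inv _ hWu, Matrix.conjTranspose_one]
    calc S = (W⁻¹ᴴ * Wᴴ) * S * (W * W⁻¹) := by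
            rw [h1, Matrix.mul_nonsing_inv _ hWu, one_mul, mul_one]
      _ = W⁻¹ᴴ * (Wᴴ * (S * W)) * W⁻¹ := by simp only [mul_assoc]
      _ = _ := by
            rw [hkey, Matrix.conjTranspose_mul, Matrix.conjTranspose_conjTranspose,
              Matrix.conjTranspose_conjTranspose]
            simp only [mul_assoc]
  · rw [← IsPosOnReal.conj_iff (D := D) (hDdet ▸ hg), ← hkey, ← mul_assoc,
      IsPosOnReal.conj_iff hWu.ne_zero]
    exact hS
  · intro z hz
    have h1 : (W⁻¹).det * C c = 1 := by
      rw [← hWdet, ← Matrix.det_mul, Matrix.nonsing_inv_mul _ hWu, Matrix.det_one]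
    have h2 : (W⁻¹).det.eval (starRingEnd ℂ z) ≠ 0 := by
      intro h0
      have := congrArg (eval (starRingEnd ℂ z)) h1
      rw [eval_mul, h0, zero_mul, eval_one] at this
      exact zero_ne_one this
    rw [Matrix.det_mul, Matrix.det_conjTranspose, Matrix.det_conjTranspose, hDdet, eval_mul,
      eval_star_poly, eval_star_poly]
    exact mul_ne_zero (star_ne_zero.2 h2) (star_ne_zero.2 hz)
  · simp [hS']
  · intro j hj
    simp [hS', hj]
  · intro j k hj hk
    simp [hS', hj, hk]

/-- The case `w k = 0` is separate because `natDegree 0 = 0`, while `d k` may exceed `e`. -/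
lemma natDegree_mulVec_le {m : ℕ} {S : Matrix (Fin m) (Fin m) ℂ[X]} {d : Fin m → ℕ}
    (hdeg : ∀ j k, (S j k).natDegree ≤ d j + d k) {e : ℕ} {w : Fin m → ℂ[X]}
    (hw : ∀ k, w k = 0 ∨ (w k).natDegree + d k ≤ e) (j : Fin m) :
    ((S *ᵥ w) j).natDegree ≤ d j + e := by
  change (∑ k, S j k * w k).natDegree ≤ d j + e
  refine natDegree_sum_le_of_forall_le _ _ fun k _ => ?_
  rcases hw k with h | h
  · simp [h]
  · exact natDegree_mul_le.trans (by linarith [hdeg j k])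

lemma natDegree_quadratic_le {m : ℕ} {S : Matrix (Fin m) (Fin m) ℂ[X]} {d : Fin m → ℕ}
    (hdeg : ∀ j k, (S j k).natDegree ≤ d j + d k) {e : ℕ} {w : Fin m → ℂ[X]}
    (hw : ∀ k, w k = 0 ∨ (w k).natDegree + d k ≤ e) :
    (star w ⬝ᵥ (S *ᵥ w)).natDegree ≤ 2 * e := by
  change (∑ k, star w k * (S *ᵥ w) k).natDegree ≤ 2 * e
  refine natDegree_sum_le_of_forall_le _ _ fun k _ => ?_
  rcases hw k with h | h
  · simp [h]
  · refine natDegree_mul_le.trans ?_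
    rw [Pi.star_apply, natDegree_star_poly]
    linarith [natDegree_mulVec_le hdeg hw k]

/-- A pivot of maximal weight in the support ensures that replacing its basis vector does not raise
the degree bounds. -/
lemma exists_max_weight {m : ℕ} (d : Fin m → ℕ) {v : Fin m → ℂ} (hv : v ≠ 0) :
    ∃ i, v i ≠ 0 ∧ ∀ j, v j ≠ 0 → d j ≤ d i := by
  classical
  obtain ⟨i₀, hi₀⟩ := Function.ne_iff.1 hv
  obtain ⟨i, hi, hmax⟩ := Finset.exists_max_image (Finset.univ.filter fun j => v j ≠ 0) d
    ⟨i₀, by simpa using hi₀⟩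
  exact ⟨i, by simpa using hi, fun j hj => hmax j (by simpa using hj)⟩

/-- `S` is conjugate, by a polynomial matrix that is nonsingular in the open upper half-plane, to a
matrix with smaller degree bounds. -/
def IsReducible {m : ℕ} (S : Matrix (Fin m) (Fin m) ℂ[X]) (d : Fin m → ℕ) : Prop :=
  ∃ (S' E : Matrix (Fin m) (Fin m) ℂ[X]) (d' : Fin m → ℕ), S = E * S' * Eᴴ ∧ IsPosOnReal S' ∧
    (∀ z : ℂ, 0 < z.im → E.det.eval z ≠ 0) ∧
    (∀ j k, (S' j k).natDegree ≤ d' j + d' k) ∧ ∑ j, d' j < ∑ j, d j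

section Reduction

variable {m : ℕ} {S : Matrix (Fin m) (Fin m) ℂ[X]} {d : Fin m → ℕ}

/-- Only the weight at `i` drops, by one: off-diagonal degrees must fall by one and the diagonal
degree by two. `hpd` forces `d i ≥ 1`, so `d i - 1` is not truncated. -/
lemma isReducible_of_division (hS : IsPosOnReal S)
    (hdeg : ∀ j k, (S j k).natDegree ≤ d j + d k)
    (i : Fin m) (w u : Fin m → ℂ[X]) (c : ℂ) (hc : c ≠ 0) (hwi : w i = C c) (g p : ℂ[X])
    (hg : g ≠ 0) (hg' : ∀ z : ℂ, z.im < 0 → g.eval z ≠ 0) (hu : ∀ j, (S *ᵥ w) j = g * u j)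
    (hp : star w ⬝ᵥ (S *ᵥ w) = star g * g * p)
    (hud : ∀ j, (u j).natDegree + 1 ≤ d j + d i) (hpd : p.natDegree + 2 ≤ 2 * d i) :
    IsReducible S d := by
  classical
  obtain ⟨S', E, hfac, hpos, hdet, hii, hji, hjk⟩ :=
    exists_conj_reduction hS i w u c hc hwi g p hg hu hp
  refine ⟨S', E, Function.update d i (d i - 1), hfac, hpos, ?_, ?_, ?_⟩
  · intro z hz
    exact hdet z (hg' _ (by simpa using hz))
  · intro j k
    by_cases hj : j = i
    · subst hj
      by_cases hk : k = j
      · subst hk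
        rw [hii, Function.update_self]
        omega
      · rw [(hji k hk).2, Function.update_self, Function.update_of_ne hk, natDegree_star_poly]
        have := hud k
        omega
    · by_cases hk : k = i
      · subst hk
        rw [(hji j hj).1, Function.update_self, Function.update_of_ne hj]
        have := hud j
        omega
      · rw [hjk j k hj hk, Function.update_of_ne hj, Function.update_of_ne hk]
        exact hdeg j k
  · refine Finset.sum_lt_sum (fun j _ => ?_) ⟨i, Finset.mem_univ i, ?_⟩
    · by_cases hj : j = i
      · subst hj
        simp
      · simp [Function.update_of_ne hj]
    · rw [Function.update_self]
      omega

lemma isReducible_of_root (hS : IsPosOnReal S) (hdeg : ∀ j k, (S j k).natDegree ≤ d j + d k)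
    {a : ℂ} (ha : 0 ≤ a.im) (hroot : S.det.eval a = 0) : IsReducible S d := by
  rw [← det_evalMatrix, ← Matrix.exists_mulVec_eq_zero_iff] at hroot
  obtain ⟨v, hv, hSv⟩ := hroot
  obtain ⟨i, hi, hmax⟩ := exists_max_weight d hv
  set w : Fin m → ℂ[X] := fun k => C (v k) with hw
  have hwd : ∀ k, w k = 0 ∨ (w k).natDegree + d k ≤ d i := by
    intro k
    by_cases hk : v k = 0
    · exact Or.inl (by simp [hw, hk])
    · exact Or.inr (by simpa [hw] using hmax k hk)
  set g : ℂ[X] := X - C a with hg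
  have hgd : g.natDegree = 1 := natDegree_X_sub_C a
  have hg0 : g ≠ 0 := X_sub_C_ne_zero a
  have hsg : star g = X - C (star a) := by simp [hg]
  have hsg0 : star g ≠ 0 := by
    rw [hsg]
    exact X_sub_C_ne_zero _
  have hdvd : ∀ j, ∃ u, (S *ᵥ w) j = g * u := by
    intro j
    refine dvd_iff_isRoot.2 ?_
    have := congrFun hSv j
    simpa [IsRoot, Matrix.mulVec, dotProduct, eval_finsetSum, hw] using this
  choose u hu using hdvd
  set q : ℂ[X] := ∑ j, star (w j) * u j with hq
  have hquad : star w ⬝ᵥ (S *ᵥ w) = g * q := by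
    simp only [dotProduct, hu, hq, Finset.mul_sum, Pi.star_apply]
    exact Finset.sum_congr rfl fun _ _ => by ring
  have hnonneg := hS.quadratic_nonneg w
  -- For real `a` a zero of a nonnegative polynomial is not simple; for nonreal `a` the self-adjoint
  -- quadratic form also vanishes at `ā ≠ a`.
  have hqroot : q.eval (star a) = 0 := by
    by_cases him : a.im = 0
    · have hare : a = (a.re : ℂ) := Complex.ext (by simp) (by simp [him])
      rw [hquad, hg, hare] at hnonneg
      have := eval_eq_zero_of_nonneg hnonneg
      rw [hare]
      simpa using this
    · have hstar : star (star w ⬝ᵥ (S *ᵥ w)) = star w ⬝ᵥ (S *ᵥ w) := by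
        apply poly_eq_of_forall_real
        intro x
        rw [eval_star_poly, Complex.conj_ofReal]
        exact Complex.conj_eq_iff_im.2 (Complex.le_def.1 (hnonneg x)).2.symm
      have h1 := eval_star_poly (star w ⬝ᵥ (S *ᵥ w)) (star a)
      rw [hstar, hquad, eval_mul, eval_mul] at h1
      have h2 : g.eval (starRingEnd ℂ (star a)) = 0 := by simp [hg]
      rw [h2, zero_mul, star_zero] at h1
      refine (mul_eq_zero.1 h1).resolve_left ?_
      simp only [hg, eval_sub, eval_X, eval_C]
      intro h3
      have := congrArg Complex.im h3
      simp at this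
      exact him (by linarith)
  obtain ⟨p, hqp⟩ := dvd_iff_isRoot.2 hqroot
  rw [← hsg] at hqp
  have hp : star w ⬝ᵥ (S *ᵥ w) = star g * g * p := by
    rw [hquad, hqp]
    ring
  have hne := hS.quadratic_ne_zero w hi (rfl : w i = C (v i))
  have hp0 : p ≠ 0 := by
    rintro rfl
    rw [hp, mul_zero] at hne
    exact hne rfl
  have hpd : p.natDegree + 2 ≤ 2 * d i := by
    have h1 := natDegree_quadratic_le hdeg hwd
    rw [hp, natDegree_mul (mul_ne_zero hsg0 hg0) hp0, natDegree_mul hsg0 hg0,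
      natDegree_star_poly, hgd] at h1
    omega
  refine isReducible_of_division hS hdeg i w u (v i) hi rfl g p hg0 ?_ hu hp ?_ hpd
  · intro z hz h0
    have : z = a := by simpa [hg, sub_eq_zero] using h0
    rw [this] at hz
    linarith
  · intro j
    by_cases hj : u j = 0
    · rw [hj, natDegree_zero]
      omega
    · have h1 := natDegree_mulVec_le hdeg hwd j
      rw [hu, natDegree_mul hg0 hj, hgd] at h1
      omega

lemma isReducible_of_singular_top (hS : IsPosOnReal S)
    (hdeg : ∀ j k, (S j k).natDegree ≤ d j + d k)
    (hsing : (Matrix.of fun j k => (S j k).coeff (d j + d k)).det = 0) : IsReducible S d := by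
  rw [← Matrix.exists_mulVec_eq_zero_iff] at hsing
  obtain ⟨v, hv, hHv⟩ := hsing
  obtain ⟨i, hi, hmax⟩ := exists_max_weight d hv
  -- The powers of `X` align the weights, so the coefficient of `(S w) j` at `d j + d i` is the
  -- `j`-th entry of the top matrix applied to `v`, namely 0.
  set w : Fin m → ℂ[X] := fun k => C (v k) * X ^ (d i - d k) with hw
  have hwi : w i = C (v i) := by simp [hw]
  have hwdeg : ∀ k, (w k).natDegree ≤ d i - d k := fun k => natDegree_C_mul_X_pow_le _ _
  have hwd : ∀ k, w k = 0 ∨ (w k).natDegree + d k ≤ d i := by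
    intro k
    by_cases hk : v k = 0
    · exact Or.inl (by simp [hw, hk])
    · have := hmax k hk
      have := hwdeg k
      exact Or.inr (by omega)
  have hcoeff : ∀ j, ((S *ᵥ w) j).coeff (d j + d i) = 0 := by
    intro j
    have h1 := congrFun hHv j
    rw [Pi.zero_apply] at h1
    rw [← h1]
    simp only [Matrix.mulVec, dotProduct, finsetSum_coeff]
    refine Finset.sum_congr rfl fun k _ => ?_
    by_cases hk : v k = 0
    · simp [hw, hk]
    · have := hmax k hk
      rw [show d j + d i = (d j + d k) + (d i - d k) by omega,
        coeff_mul_add_eq_of_natDegree_le (hdeg j k) (hwdeg k)]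
      simp [hw]
  have hdegSw := natDegree_mulVec_le hdeg hwd
  have hqcoeff : (star w ⬝ᵥ (S *ᵥ w)).coeff (2 * d i) = 0 := by
    simp only [dotProduct, finsetSum_coeff, Pi.star_apply]
    refine Finset.sum_eq_zero fun j _ => ?_
    by_cases hj : v j = 0
    · simp [hw, hj]
    · have := hmax j hj
      rw [show 2 * d i = (d i - d j) + (d j + d i) by omega,
        coeff_mul_add_eq_of_natDegree_le ((natDegree_star_poly _).le.trans (hwdeg j)) (hdegSw j),
        hcoeff, mul_zero]
  have hqd := natDegree_quadratic_le hdeg hwd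
  have hdi : d i ≠ 0 := by
    intro h0
    rw [h0, mul_zero] at hqd hqcoeff
    apply hS.quadratic_ne_zero w hi hwi
    rw [eq_C_of_natDegree_le_zero hqd, hqcoeff, C_0]
  -- Vanishing of the top coefficient gains one degree; evenness on the line gains the second.
  have hqd' : (star w ⬝ᵥ (S *ᵥ w)).natDegree ≤ 2 * (d i - 1) := by
    apply natDegree_le_of_nonneg (hS.quadratic_nonneg w)
    have := natDegree_le_pred hqd hqcoeff
    omega
  refine isReducible_of_division hS hdeg i w (S *ᵥ w) (v i) hi hwi 1 _ one_ne_zero ?_ ?_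
    (by rw [star_one, one_mul, one_mul]) ?_ ?_
  · simp
  · simp
  · intro j
    have := natDegree_le_pred (hdegSw j) (hcoeff j)
    omega
  · omega

lemma isReducible_of_sum_pos (hS : IsPosOnReal S)
    (hdeg : ∀ j k, (S j k).natDegree ≤ d j + d k) (hd : 0 < ∑ j, d j) : IsReducible S d := by
  by_cases hdet : S.det.natDegree = 0
  · apply isReducible_of_singular_top hS hdeg
    rw [← coeff_det_of_natDegree_le S d hdeg]
    exact coeff_eq_zero_of_natDegree_lt (by omega)
  · obtain ⟨a, ha⟩ := Complex.exists_root (f := S.det)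
      (natDegree_pos_iff_degree_pos.1 (Nat.pos_of_ne_zero hdet))
    rcases le_total 0 a.im with h | h
    · exact isReducible_of_root hS hdeg h ha
    -- `det S` is self-adjoint, so a zero in the lower half-plane reflects to the upper one.
    · refine isReducible_of_root hS hdeg (a := starRingEnd ℂ a) (by simpa using h) ?_
      have h1 := eval_star_poly S.det (starRingEnd ℂ a)
      rw [← Matrix.det_conjTranspose, hS.conjTranspose_eq, Complex.conj_conj, ha.eq_zero,
        star_zero] at h1
      exact h1

end Reduction

/-! ### Existence and degree of the factor -/

open scoped MatrixOrder in
lemma exists_mul_conjTranspose_of_posSemidef {m : ℕ} {P : Matrix (Fin m) (Fin m) ℂ}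
    (hP : P.PosSemidef) : ∃ Q, P = Q * Qᴴ := by
  obtain ⟨Q, hQ⟩ := CStarAlgebra.nonneg_iff_eq_star_mul_self.1 hP.nonneg
  exact ⟨Qᴴ, by rw [Matrix.conjTranspose_conjTranspose]; exact hQ⟩

theorem IsPosOnReal.exists_factor {m : ℕ} {S : Matrix (Fin m) (Fin m) ℂ[X]} (hS : IsPosOnReal S) :
    ∃ F : Matrix (Fin m) (Fin m) ℂ[X], S = F * Fᴴ ∧ ∀ z : ℂ, 0 < z.im → F.det.eval z ≠ 0 := by
  suffices h : ∀ (n : ℕ) (S : Matrix (Fin m) (Fin m) ℂ[X]) (d : Fin m → ℕ), IsPosOnReal S →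
      (∀ j k, (S j k).natDegree ≤ d j + d k) → ∑ j, d j = n →
      ∃ F : Matrix (Fin m) (Fin m) ℂ[X], S = F * Fᴴ ∧ ∀ z : ℂ, 0 < z.im → F.det.eval z ≠ 0 by
    -- Any admissible weights will do: the degree of the factor is bounded afterwards by
    -- `natDegree_le_of_mul_conjTranspose`.
    refine h _ S (fun j => ∑ k, ((S j k).natDegree + (S k j).natDegree)) hS (fun j k => ?_) rfl
    refine le_add_right ((Nat.le_add_right _ (S k j).natDegree).trans ?_)
    exact Finset.single_le_sum (f := fun k => (S j k).natDegree + (S k j).natDegree)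
      (fun _ _ => Nat.zero_le _) (Finset.mem_univ k)
  intro n
  induction n using Nat.strong_induction_on with
  | _ n ih =>
    intro S d hS hdeg hsum
    rcases Nat.eq_zero_or_pos n with h0 | hpos
    · have hd : ∀ j, d j = 0 := by
        rw [h0] at hsum
        exact fun j => (Finset.sum_eq_zero_iff.1 hsum) j (Finset.mem_univ j)
      set P : Matrix (Fin m) (Fin m) ℂ := S.map fun p => p.coeff 0 with hP
      have hSP : S = (C : ℂ →+* ℂ[X]).mapMatrix P := by
        ext1 j k
        have := hdeg j k
        rw [hd, hd] at this
        exact eq_C_of_natDegree_le_zero this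
      have heval : ∀ z, evalMatrix z S = P := by
        intro z
        rw [hSP]
        ext j k
        simp
      obtain ⟨x, hx⟩ := hS.exists
      rw [heval] at hx
      obtain ⟨Q, hQ⟩ := exists_mul_conjTranspose_of_posSemidef hx.posSemidef
      have hQdet : Q.det ≠ 0 := by
        intro h
        have := hx.det_pos.ne'
        rw [hQ, Matrix.det_mul, h, zero_mul] at this
        exact this rfl
      refine ⟨(C : ℂ →+* ℂ[X]).mapMatrix Q, ?_, ?_⟩
      · rw [hSP, hQ, map_mul]
        congr 1
        ext1 j k
        simp [Matrix.conjTranspose_apply]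
      · intro z _
        rw [← RingHom.map_det]
        simpa using hQdet
    · obtain ⟨S', E, d', hfac, hS', hE, hdeg', hlt⟩ :=
        isReducible_of_sum_pos hS hdeg (by omega)
      obtain ⟨F, hF, hFdet⟩ := ih _ (hsum ▸ hlt) S' d' hS' hdeg' rfl
      refine ⟨E * F, ?_, ?_⟩
      · rw [hfac, hF, Matrix.conjTranspose_mul]
        simp only [mul_assoc]
      · intro z hz
        rw [Matrix.det_mul, eval_mul]
        exact mul_ne_zero (hE z hz) (hFdet z hz)

/-- With `D` the largest degree in row `i`, the coefficient at `2D` of the diagonal entry is a sum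
of squared moduli, so leading terms cannot cancel. -/
lemma natDegree_le_of_mul_conjTranspose {m N : ℕ} {F : Matrix (Fin m) (Fin m) ℂ[X]} {i : Fin m}
    (h : ((F * Fᴴ) i i).natDegree ≤ 2 * N) (j : Fin m) : (F i j).natDegree ≤ N := by
  set D := Finset.univ.sup fun k => (F i k).natDegree with hD
  have hle : ∀ k, (F i k).natDegree ≤ D := fun k =>
    Finset.le_sup (f := fun k => (F i k).natDegree) (Finset.mem_univ k)
  refine (hle j).trans ?_
  by_contra! hlt
  have hc : ((F * Fᴴ) i i).coeff (D + D) = 0 := coeff_eq_zero_of_natDegree_lt (by omega)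
  have hterm : ∀ k, (F i k * Fᴴ k i).coeff (D + D) = (F i k).coeff D * star ((F i k).coeff D) := by
    intro k
    rw [Matrix.conjTranspose_apply, coeff_mul_add_eq_of_natDegree_le (hle k)
      ((natDegree_star_poly _).le.trans (hle k)), coeff_star_poly]
  rw [Matrix.mul_apply, finsetSum_coeff, Finset.sum_congr rfl fun k _ => hterm k,
    Finset.sum_eq_zero_iff_of_nonneg fun k _ => mul_star_self_nonneg _] at hc
  obtain ⟨k, -, hk⟩ := Finset.exists_mem_eq_sup Finset.univ ⟨j, Finset.mem_univ j⟩
    fun k => (F i k).natDegree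
  have h0 : (F i k).coeff D = 0 := by simpa using hc k (Finset.mem_univ k)
  have hk' : D = (F i k).natDegree := hk
  rw [hk', coeff_natDegree, leadingCoeff_eq_zero] at h0
  rw [h0, natDegree_zero] at hk'
  omega

/-! ### Uniqueness up to a unitary constant -/

lemma natDegree_eq_zero_of_bounded {p : ℂ[X]} {c : ℝ} (h : ∀ᵐ x : ℝ, ‖p.eval (x : ℂ)‖ ≤ c) :
    p.natDegree = 0 := by
  by_contra hp
  have h' : ∀ x : ℝ, ‖p.eval (x : ℂ)‖ ≤ c :=
    forall_real_of_ae (P := fun z => ‖p.eval z‖ ≤ c)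
      (isClosed_le (continuous_eval_ofReal p).norm continuous_const) h
  have ht := p.tendsto_norm_atTop (natDegree_pos_iff_degree_pos.1 (Nat.pos_of_ne_zero hp))
    (l := Filter.atTop) (z := fun x : ℝ => (x : ℂ))
    (by simpa using Filter.tendsto_abs_atTop_atTop)
  obtain ⟨x, hx⟩ := (ht.eventually_gt_atTop c).exists
  exact absurd (h' x) (not_le.2 hx)

/-- A rational function `p / q` that has no poles off the real line and is bounded on it is
constant. -/
lemma exists_eq_C_mul_of_bounded {r : ℂ[X]} (hr : ∀ z : ℂ, z.im < 0 → r.eval z ≠ 0) :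
    ∀ (n : ℕ) (p q s : ℂ[X]), q.natDegree = n → q ≠ 0 → (∀ z : ℂ, 0 < z.im → q.eval z ≠ 0) →
      p * r = q * s → (∀ᵐ x : ℝ, ‖p.eval (x : ℂ)‖ ≤ ‖q.eval (x : ℂ)‖) → ∃ c, p = C c * q := by
  intro n
  induction n with
  | zero =>
    intro p q s hn hq hq' hs hb
    rw [eq_C_of_natDegree_eq_zero hn] at hq hb ⊢
    simp only [eval_C] at hb
    rw [eq_C_of_natDegree_eq_zero (natDegree_eq_zero_of_bounded hb)]
    have h0 : q.coeff 0 ≠ 0 := by simpa using hq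
    exact ⟨p.coeff 0 / q.coeff 0, by rw [← C_mul, div_mul_cancel₀ _ h0]⟩
  | succ n ih =>
    intro p q s hn hq hq' hs hb
    obtain ⟨a, ha⟩ := Complex.exists_root (f := q) (natDegree_pos_iff_degree_pos.1 (by omega))
    -- Each zero of `q` cancels against `p`: below the line by `p r = q s`, on it by the bound,
    -- above it there is none.
    have hpa : p.eval a = 0 := by
      rcases lt_trichotomy a.im 0 with h | h | h
      · have h1 := congrArg (eval a) hs
        rw [eval_mul, eval_mul, ha.eq_zero, zero_mul] at h1
        exact (mul_eq_zero.1 h1).resolve_right (hr a h)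
      · have hare : a = (a.re : ℂ) := Complex.ext (by simp) (by simp [h])
        have hb' := forall_real_of_ae (P := fun z => ‖p.eval z‖ ≤ ‖q.eval z‖)
          (isClosed_le (continuous_eval_ofReal p).norm (continuous_eval_ofReal q).norm) hb a.re
        rw [← hare, ha.eq_zero, norm_zero] at hb'
        exact norm_le_zero_iff.1 hb'
      · exact absurd ha (hq' a h)
    obtain ⟨q', rfl⟩ := dvd_iff_isRoot.2 ha
    obtain ⟨p', rfl⟩ := dvd_iff_isRoot.2 hpa
    have ha0 : (X - C a) ≠ 0 := X_sub_C_ne_zero a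
    have hq0 : q' ≠ 0 := right_ne_zero_of_mul hq
    suffices h : ∃ c, p' = C c * q' by
      obtain ⟨c, hc⟩ := h
      exact ⟨c, by rw [hc]; ring⟩
    refine ih p' q' s ?_ hq0 ?_ ?_ ?_
    · rw [natDegree_mul ha0 hq0, natDegree_X_sub_C] at hn
      omega
    · intro z hz h0
      exact hq' z hz (by rw [eval_mul, h0, mul_zero])
    · apply mul_left_cancel₀ ha0
      rw [← mul_assoc, hs, mul_assoc]
    · have hne : ∀ᵐ x : ℝ, (x : ℂ) ≠ a := by
        have hsub : {x : ℝ | (x : ℂ) = a}.Subsingleton := fun x hx y hy =>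
          Complex.ofReal_injective (hx.trans hy.symm)
        exact hsub.finite.countable.ae_notMem volume
      filter_upwards [hb, hne] with x hx hxa
      rw [eval_mul, eval_mul, norm_mul, norm_mul] at hx
      refine le_of_mul_le_mul_left hx (norm_pos_iff.2 ?_)
      simpa [sub_eq_zero] using hxa

/-- The factor that is nonsingular in the open upper half-plane is unique up to a constant unitary
factor on the right. -/
theorem IsPosOnReal.exists_unitary {m : ℕ} {F T : Matrix (Fin m) (Fin m) ℂ[X]}
    (hS : IsPosOnReal (F * Fᴴ)) (hT : F * Fᴴ = T * Tᴴ)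
    (hFdet : ∀ z : ℂ, 0 < z.im → F.det.eval z ≠ 0)
    (hTdet : ∀ z : ℂ, 0 < z.im → T.det.eval z ≠ 0) :
    ∃ U ∈ Matrix.unitaryGroup (Fin m) ℂ, T = F * (C : ℂ →+* ℂ[X]).mapMatrix U := by
  have hF0 : F.det ≠ 0 := by
    have := hS.det_ne_zero
    rw [Matrix.det_mul] at this
    exact left_ne_zero_of_mul this
  -- `M = det F • F⁻¹ T`, which avoids rational functions.
  set M := F.adjugate * T with hM
  have hFM : F * M = F.det • T := by
    rw [hM, ← mul_assoc, Matrix.mul_adjugate, Matrix.smul_mul, one_mul]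
  -- Denominator-free form of `F⁻¹ T = Fᴴ (Tᴴ)⁻¹`.
  have hrel : Tᴴ.det • M = F.det • (Fᴴ * Tᴴ.adjugate) := by
    calc Tᴴ.det • M = F.adjugate * (T * (Tᴴ * Tᴴ.adjugate)) := by
          rw [Matrix.mul_adjugate, Matrix.mul_smul, mul_one, Matrix.mul_smul]
      _ = F.adjugate * (F * Fᴴ) * Tᴴ.adjugate := by
          rw [hT]
          simp only [mul_assoc]
      _ = (F.adjugate * F) * (Fᴴ * Tᴴ.adjugate) := by simp only [mul_assoc]
      _ = F.det • (Fᴴ * Tᴴ.adjugate) := by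
          rw [Matrix.adjugate_mul, Matrix.smul_mul, one_mul]
  have hpoint : ∀ᵐ x : ℝ, ∃ V ∈ Matrix.unitaryGroup (Fin m) ℂ,
      evalMatrix (x : ℂ) T = evalMatrix (x : ℂ) F * V ∧ IsUnit (evalMatrix (x : ℂ) F).det := by
    filter_upwards [hS] with x hx
    have hfac : ∀ G : Matrix (Fin m) (Fin m) ℂ[X],
        evalMatrix (x : ℂ) (G * Gᴴ) = evalMatrix (x : ℂ) G * (evalMatrix (x : ℂ) G)ᴴ := by
      intro G
      rw [map_mul, evalMatrix_conjTranspose, Complex.conj_ofReal]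
    have hu : IsUnit (evalMatrix (x : ℂ) F).det := by
      have := hx.det_pos.ne'
      rw [hfac, Matrix.det_mul] at this
      exact (left_ne_zero_of_mul this).isUnit
    have hTT := congrArg (evalMatrix (x : ℂ)) hT
    rw [hfac, hfac] at hTT
    set A := evalMatrix (x : ℂ) F
    set B := evalMatrix (x : ℂ) T
    refine ⟨A⁻¹ * B, ?_, ?_, hu⟩
    · rw [Matrix.mem_unitaryGroup_iff, Matrix.star_eq_conjTranspose, Matrix.conjTranspose_mul]
      have hu' : A⁻¹ * A = 1 := Matrix.nonsing_inv_mul _ hu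
      calc A⁻¹ * B * (Bᴴ * A⁻¹ᴴ) = A⁻¹ * (B * Bᴴ) * A⁻¹ᴴ := by simp only [mul_assoc]
        _ = (A⁻¹ * A) * (A⁻¹ * A)ᴴ := by
          rw [← hTT, Matrix.conjTranspose_mul]
          simp only [mul_assoc]
        _ = 1 := by rw [hu', Matrix.conjTranspose_one, one_mul]
    · rw [← mul_assoc, Matrix.mul_nonsing_inv _ hu, one_mul]
  have hconst : ∀ i j, ∃ c, M i j = C c * F.det := by
    intro i j
    refine exists_eq_C_mul_of_bounded (r := Tᴴ.det) ?_ _ _ _ ((Fᴴ * Tᴴ.adjugate) i j) rfl hF0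
      hFdet ?_ ?_
    · intro z hz
      rw [Matrix.det_conjTranspose, eval_star_poly]
      exact star_ne_zero.2 (hTdet _ (by simpa using hz))
    · have := congrFun (congrFun hrel i) j
      simp only [Matrix.smul_apply, smul_eq_mul] at this
      rw [mul_comm, this]
    · filter_upwards [hpoint] with x ⟨V, hV, hTV, hu⟩
      have hMV : evalMatrix (x : ℂ) M = F.det.eval (x : ℂ) • V := by
        have h1 := congrArg (evalMatrix (x : ℂ)) (Matrix.adjugate_mul F)
        rw [hM, map_mul, hTV, ← mul_assoc, ← map_mul, h1]
        ext k l
        simp [Matrix.mul_apply, Matrix.one_apply, apply_ite]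
      have h2 : (M i j).eval (x : ℂ) = F.det.eval (x : ℂ) * V i j :=
        congrFun (congrFun hMV i) j
      rw [h2, norm_mul]
      exact mul_le_of_le_one_right (norm_nonneg _) (entry_norm_bound_of_unitary hV i j)
  choose U hU using hconst
  have hTU : T = F * (C : ℂ →+* ℂ[X]).mapMatrix (Matrix.of U) := by
    have hMU : M = F.det • (C : ℂ →+* ℂ[X]).mapMatrix (Matrix.of U) := by
      ext1 i j
      rw [hU]
      simp [mul_comm]
    rw [hMU, Matrix.mul_smul] at hFM
    ext1 i j
    have := congrFun (congrFun hFM i) j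
    exact (mul_left_cancel₀ hF0 this).symm
  refine ⟨Matrix.of U, ?_, hTU⟩
  -- One real point where `F` is invertible identifies the constant matrix with a unitary one.
  obtain ⟨x, V, hV, hTV, hu⟩ := hpoint.exists
  have h1 := congrArg (evalMatrix (x : ℂ)) hTU
  have h2 : evalMatrix (x : ℂ) ((C : ℂ →+* ℂ[X]).mapMatrix (Matrix.of U)) = Matrix.of U := by
    ext i j
    simp
  rw [map_mul, h2, hTV] at h1
  have h3 := congrArg ((evalMatrix (x : ℂ) F)⁻¹ * ·) h1
  simp only [← mul_assoc, Matrix.nonsing_inv_mul _ hu, one_mul] at h3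
  exact h3 ▸ hV

/-! ### Coefficient sequences and the theorem -/

/-- The matrix of polynomials with coefficient matrices `A 0, …, A d`. -/
noncomputable def polynomialMatrix {m : ℕ} (d : ℕ) (A : ℕ → Matrix (Fin m) (Fin m) ℂ) :
    Matrix (Fin m) (Fin m) ℂ[X] :=
  Matrix.of fun i j => ∑ n ∈ Finset.range (d + 1), monomial n (A n i j)

section polynomialMatrix

variable {m d : ℕ}

lemma evalMatrix_polynomialMatrix (A : ℕ → Matrix (Fin m) (Fin m) ℂ) (z : ℂ) :
    evalMatrix z (polynomialMatrix d A) = matrixPoly d A z := by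
  ext i j
  simp [polynomialMatrix, matrixPoly, eval_finsetSum, Matrix.sum_apply, mul_comm]

lemma coeff_polynomialMatrix (A : ℕ → Matrix (Fin m) (Fin m) ℂ) (i j : Fin m) {n : ℕ}
    (hn : n ≤ d) : (polynomialMatrix d A i j).coeff n = A n i j := by
  simp [polynomialMatrix, coeff_monomial, hn]

lemma natDegree_polynomialMatrix_le (A : ℕ → Matrix (Fin m) (Fin m) ℂ) (i j : Fin m) :
    (polynomialMatrix d A i j).natDegree ≤ d :=
  natDegree_sum_le_of_forall_le _ _ fun _ hn =>
    (natDegree_monomial_le _).trans (Nat.lt_succ_iff.1 (Finset.mem_range.1 hn))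

lemma polynomialMatrix_coeff {F : Matrix (Fin m) (Fin m) ℂ[X]}
    (hF : ∀ i j, (F i j).natDegree ≤ d) :
    polynomialMatrix d (fun n => F.map fun p => p.coeff n) = F := by
  ext1 i j
  exact ((F i j).as_sum_range' (d + 1) (Nat.lt_succ_of_le (hF i j))).symm

lemma polynomialMatrix_ext {F G : Matrix (Fin m) (Fin m) ℂ[X]}
    (h : ∀ z, evalMatrix z F = evalMatrix z G) : F = G := by
  ext1 i j
  exact Polynomial.funext fun z => congrFun (congrFun (h z) i) j

lemma adjointFun_matrixPoly (A : ℕ → Matrix (Fin m) (Fin m) ℂ) (z : ℂ) :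
    adjointFun (matrixPoly d A) z = matrixPoly d (fun n => (A n)ᴴ) z := by
  simp [adjointFun, matrixPoly, Matrix.conjTranspose_sum, Matrix.conjTranspose_smul]

lemma evalMatrix_conjTranspose_polynomialMatrix (A : ℕ → Matrix (Fin m) (Fin m) ℂ) (z : ℂ) :
    evalMatrix z (polynomialMatrix d A)ᴴ = adjointFun (matrixPoly d A) z := by
  rw [evalMatrix_conjTranspose, evalMatrix_polynomialMatrix, adjointFun]

lemma isSpectralFactor_iff {d' : ℕ} (S A : ℕ → Matrix (Fin m) (Fin m) ℂ) :
    IsSpectralFactor (matrixPoly d' S) (matrixPoly d A) ↔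
      polynomialMatrix d' S = polynomialMatrix d A * (polynomialMatrix d A)ᴴ ∧
        ∀ z : ℂ, 0 < z.im → (polynomialMatrix d A).det.eval z ≠ 0 := by
  simp only [← det_evalMatrix, evalMatrix_polynomialMatrix]
  constructor
  · rintro ⟨h1, h2⟩
    refine ⟨polynomialMatrix_ext fun z => ?_, h2⟩
    rw [map_mul, evalMatrix_conjTranspose_polynomialMatrix, evalMatrix_polynomialMatrix,
      evalMatrix_polynomialMatrix, h1]
  · rintro ⟨h1, h2⟩
    refine ⟨fun z => ?_, h2⟩
    rw [← evalMatrix_polynomialMatrix, h1, map_mul, evalMatrix_conjTranspose_polynomialMatrix,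
      evalMatrix_polynomialMatrix]

end polynomialMatrix

theorem theorem2 (m N : ℕ) (C : ℕ → Matrix (Fin m) (Fin m) ℂ)
    (hpos : ∀ᵐ x : ℝ ∂MeasureTheory.volume, (matrixPoly (2 * N) C (x : ℂ)).PosDef) :
    ∃ A : ℕ → Matrix (Fin m) (Fin m) ℂ,
      IsSpectralFactor (matrixPoly (2 * N) C) (matrixPoly N A) ∧
      (C (2 * N) ≠ 0 → A N ≠ 0) ∧
      (∀ z : ℂ, adjointFun (matrixPoly N A) z = matrixPoly N (fun n => (A n)ᴴ) z) ∧
      (∀ z : ℂ, z.im < 0 → (adjointFun (matrixPoly N A) z).det ≠ 0) ∧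
      ∀ B : ℕ → Matrix (Fin m) (Fin m) ℂ,
        IsSpectralFactor (matrixPoly (2 * N) C) (matrixPoly N B) ↔
          ∃ U ∈ Matrix.unitaryGroup (Fin m) ℂ,
            ∀ z : ℂ, matrixPoly N B z = matrixPoly N A z * U := by
  have hS : IsPosOnReal (polynomialMatrix (2 * N) C) := by
    filter_upwards [hpos] with x hx
    rwa [evalMatrix_polynomialMatrix]
  obtain ⟨F, hF, hFdet⟩ := hS.exists_factor
  have hFdeg : ∀ i j, (F i j).natDegree ≤ N := fun i =>
    natDegree_le_of_mul_conjTranspose (hF ▸ natDegree_polynomialMatrix_le C i i)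
  set A : ℕ → Matrix (Fin m) (Fin m) ℂ := fun n => F.map fun p => p.coeff n with hA
  have hFA : polynomialMatrix N A = F := polynomialMatrix_coeff hFdeg
  have hfac : IsSpectralFactor (matrixPoly (2 * N) C) (matrixPoly N A) := by
    rw [isSpectralFactor_iff, hFA]
    exact ⟨hF, hFdet⟩
  refine ⟨A, hfac, ?_, adjointFun_matrixPoly A, ?_, ?_⟩
  · intro hC hAN
    apply hC
    ext i j
    -- The degree bound `N` on the factor makes `C (2 * N) = A N * (A N)ᴴ`.
    rw [← coeff_polynomialMatrix C i j le_rfl, hF, Matrix.mul_apply, finsetSum_coeff]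
    refine Finset.sum_eq_zero fun k _ => ?_
    have h0 : (F i k).coeff N = 0 := congrFun (congrFun hAN i) k
    rw [two_mul, Matrix.conjTranspose_apply, coeff_mul_add_eq_of_natDegree_le (hFdeg i k)
      ((natDegree_star_poly _).le.trans (hFdeg j k)), h0, zero_mul]
  · intro z hz
    rw [adjointFun, Matrix.det_conjTranspose]
    exact star_ne_zero.2 (hfac.nonsingular _ (by simpa using hz))
  · intro B
    constructor
    · intro hB
      obtain ⟨hB1, hB2⟩ := (isSpectralFactor_iff C B).1 hB
      obtain ⟨U, hU, hBU⟩ := IsPosOnReal.exists_unitary (hF ▸ hS) (hF ▸ hB1) hFdet hB2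
      refine ⟨U, hU, fun z => ?_⟩
      rw [← evalMatrix_polynomialMatrix, ← evalMatrix_polynomialMatrix, hBU, hFA, map_mul]
      congr 1
      ext i j
      simp
    · rintro ⟨U, hU, hBU⟩
      have hU' : U * Uᴴ = 1 := Matrix.mem_unitaryGroup_iff.1 hU
      refine ⟨fun z => ?_, fun z hz => ?_⟩
      · rw [hfac.factorization, adjointFun, adjointFun, hBU, hBU, Matrix.conjTranspose_mul,
          mul_assoc, ← mul_assoc U, hU', one_mul]
      · rw [hBU, Matrix.det_mul]
        refine mul_ne_zero (hfac.nonsingular z hz) ?_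
        have := congrArg Matrix.det hU'
        rw [Matrix.det_mul, Matrix.det_one] at this
        exact left_ne_zero_of_mul_eq_one this
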